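/- Let $n\ge 3$ be odd, let $P_n$ be the path graph on the nodes $1,\dots,n$ (in path order), let $L$ be its Laplacian matrix, and let $p^*=\frac{n+1}{2}$. Let $0<\tau<1/\Delta(P_n)$, where $\Delta(P_n)$ is the maximum degree, and put $Z=I-\tau L$. Let $e_1,\dots,e_n$ be the standard basis of $\mathbb{R}^n$, and let $\lambda_{\min},\lambda_{\max}$ denote the smallest and largest eigenvalue of a real symmetric matrix. For real $\varepsilon$ and a node $p$ let $\lambda_{\min}(\varepsilon,p)=\lambda_{\min}(L+\varepsilon e_pe_p^T)$. Below, $n$ and $\tau$ are fixed, $O(\varepsilon^3)$ is as $\varepsilon\to0$ through real values of both signs, and "for all sufficiently small" is allowed to depend on $n$ and $\tau$. 1. There are real numbers $\beta_1,\dots,\beta_n$ with $\lambda_{\min}(\varepsilon,p)=\frac{\varepsilon}{n}+\beta_p\varepsilon^2+O(\varepsilon^3)$ for every $p$, and $\beta_p<\beta_{p^*}$ for all $p\ne p^*$. For all $\varepsilon\neq0$ of sufficiently small absolute value, $\lambda_{\min}(\varepsilon,p)<\lambda_{\min}(\varepsilon,p^*)$ for all $p\neq p^*$. Moreover $$\max_{1\le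 p\le n}\lambda_{\min}(\varepsilon,p)=\frac{\varepsilon}{n}-\frac{\varepsilon^2}{4n}\sum_{j=2}^{n}\frac{\cos^2\left(\frac{\pi(j-1)}{2}\right)}{\sin^2\left(\frac{\pi(j-1)}{2n}\right)\sum_{i=1}^{n}\cos^2\left(\frac{\pi(j-1)(i-\frac12)}{n}\right)}+O(\varepsilon^3)$$ and, for every real $\varepsilon$, the main term on the right-hand side equals $\frac{\varepsilon}{n}-\frac{\varepsilon^2(n^2-1)}{12n^2}$. 2. The node $p^*$ is the unique center for each of the following three criteria. - MPLSE: for all $\varepsilon\ne0$ of sufficiently small absolute value, $p^*$ is the unique maximizer of $p\mapsto\lambda_{\min}(L-\varepsilon e_pe_p^T)$. - MSub-LE: $p^*$ is the unique minimizer of $p\mapsto\lambda_{\max}(\widehat Z_p)$, where $\widehat Z_p$ is $Z$ with row and column $p$ removed. - MSup-LE: for all sufficiently small $\varepsilon>0$, $p^*$ is the unique minimizer of $p\mapsto\lambda_{\max}(Z+\varepsilon e_pe_p^T)$. The same holds for the second-order approximation: there are real numbers $\gamma_1,\dots,\gamma_n$ with $\lambda_{\max}(Z+\varepsilon e_pe_p^T)=1+\frac{\varepsilon}{n}+\gamma_p\varepsilon^2+O(\varepsilon^3)$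 for every $p$, and $\gamma_{p^*}<\gamma_p$ for all $p\ne p^*$. 3. Let $\lambda_2$ be the second smallest eigenvalue of $L$ (counted with multiplicity). For every nonzero $v\in\mathbb{R}^n$ with $Lv=\lambda_2v$ and every node $j$, $v(j)=0$ if and only if $j=p^*$. -/

import Mathlib

open Filter Topology Asymptotics
open scoped Matrix

noncomputable section

namespace PathCenter

/-- Smallest eigenvalue of a real symmetric matrix with nonempty index type
(the spectrum is then a finite nonempty set of real eigenvalues, see `isLeast_lamMin`). -/
def lamMin {V : Type*} [Fintype V] [DecidableEq V] (A : Matrix V V ℝ) : ℝ :=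
  sInf (spectrum ℝ A)

/-- Largest eigenvalue of a real symmetric matrix with nonempty index type
(see `isGreatest_lamMax`). -/
def lamMax {V : Type*} [Fintype V] [DecidableEq V] (A : Matrix V V ℝ) : ℝ :=
  sSup (spectrum ℝ A)

theorem isLeast_lamMin {V : Type*} [Fintype V] [DecidableEq V] [Nonempty V]
    {A : Matrix V V ℝ} (hA : A.IsHermitian) : IsLeast (spectrum ℝ A) (lamMin A) := by
  have hs := hA.spectrum_real_eq_range_eigenvalues
  have hf : (spectrum ℝ A).Finite := by rw [hs]; exact Set.finite_range _
  have hn : (spectrum ℝ A).Nonempty := by rw [hs]; exact Set.range_nonempty _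
  exact ⟨hn.csInf_mem hf, fun x hx => csInf_le hf.bddBelow hx⟩

theorem isGreatest_lamMax {V : Type*} [Fintype V] [DecidableEq V] [Nonempty V]
    {A : Matrix V V ℝ} (hA : A.IsHermitian) : IsGreatest (spectrum ℝ A) (lamMax A) := by
  have hs := hA.spectrum_real_eq_range_eigenvalues
  have hf : (spectrum ℝ A).Finite := by rw [hs]; exact Set.finite_range _
  have hn : (spectrum ℝ A).Nonempty := by rw [hs]; exact Set.range_nonempty _
  exact ⟨hn.csSup_mem hf, fun x hx => le_csSup hf.bddAbove hx⟩

/-- The `i`-th eigenvalue (counted from `0`, with multiplicity) of a real symmetric matrix in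
ascending order; Mathlib's `eigenvalues₀` lists them in descending order. -/
def eigAsc {V : Type*} [Fintype V] [DecidableEq V] {A : Matrix V V ℝ} (hA : A.IsHermitian)
    (i : Fin (Fintype.card V)) : ℝ :=
  hA.eigenvalues₀ i.rev

theorem isHermitian_lapMatrix {V : Type*} [Fintype V] [DecidableEq V]
    (G : SimpleGraph V) [DecidableRel G.Adj] : (G.lapMatrix ℝ).IsHermitian := by
  rw [Matrix.IsHermitian, Matrix.conjTranspose_eq_transpose_of_trivial]
  exact G.isSymm_lapMatrix (R := ℝ)

/-- The matrix `∑_{j ∈ S} e_j e_jᵀ`. -/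
def portMatrix {V : Type*} [DecidableEq V] (S : Finset V) : Matrix V V ℝ :=
  ∑ j ∈ S, Matrix.single j j (1 : ℝ)

/-- The doubly stochastic matrix `Z = I - τ L` of a graph. -/
def stochMatrix {V : Type*} [Fintype V] [DecidableEq V]
    (G : SimpleGraph V) [DecidableRel G.Adj] (τ : ℝ) : Matrix V V ℝ :=
  1 - τ • G.lapMatrix ℝ

/-- Node sets of size `k` that are best for the MPLSE criterion (maximized perturbed Laplacian
smallest eigenvalue): they maximize `λ_min (L - ε ∑_{j ∈ S} e_j e_jᵀ)` over all `S` with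
`|S| = k`. -/
def mplseSets {V : Type*} [Fintype V] [DecidableEq V]
    (G : SimpleGraph V) [DecidableRel G.Adj] (ε : ℝ) (k : ℕ) : Set (Finset V) :=
  {S | S.card = k ∧ ∀ T : Finset V, T.card = k →
    lamMin (G.lapMatrix ℝ - ε • portMatrix T) ≤ lamMin (G.lapMatrix ℝ - ε • portMatrix S)}

/-- The principal submatrix of `A` obtained by removing the rows and columns indexed by `S`. -/
def removeNodes {V : Type*} (A : Matrix V V ℝ) (S : Finset V) :
    Matrix {i : V // i ∉ S} {i : V // i ∉ S} ℝ :=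
  A.submatrix Subtype.val Subtype.val

/-- Node sets of size `k` that are best for the MSub-LE criterion (minimized sub-stochastic
largest eigenvalue): they minimize `λ_max` of `Z` with the rows and columns in `S` removed. -/
def msubSets {V : Type*} [Fintype V] [DecidableEq V]
    (G : SimpleGraph V) [DecidableRel G.Adj] (τ : ℝ) (k : ℕ) : Set (Finset V) :=
  {S | S.card = k ∧ ∀ T : Finset V, T.card = k →
    lamMax (removeNodes (stochMatrix G τ) S) ≤ lamMax (removeNodes (stochMatrix G τ) T)}

/-- Node sets of size `k` that are best for the MSup-LE criterion (minimized super-stochastic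
largest eigenvalue): they minimize `λ_max (Z + ε ∑_{j ∈ S} e_j e_jᵀ)` over all `S` with
`|S| = k`. -/
def msupSets {V : Type*} [Fintype V] [DecidableEq V]
    (G : SimpleGraph V) [DecidableRel G.Adj] (τ ε : ℝ) (k : ℕ) : Set (Finset V) :=
  {S | S.card = k ∧ ∀ T : Finset V, T.card = k →
    lamMax (stochMatrix G τ + ε • portMatrix S) ≤ lamMax (stochMatrix G τ + ε • portMatrix T)}

/-- `f ε = q ε + O(ε³)` as `ε → 0` (through both signs): `f` and `q` agree up to second order. -/
def AgreeUpToSecondOrder (f q : ℝ → ℝ) : Prop :=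
  (fun ε => f ε - q ε) =O[𝓝 0] fun ε => ε ^ 3

instance decidableRelPathGraphAdj (n : ℕ) : DecidableRel (SimpleGraph.pathGraph n).Adj :=
  fun _ _ => decidable_of_iff _ SimpleGraph.pathGraph_adj.symm

/-- The Laplacian matrix of the path graph `P_n`. The node labelled `i ∈ {1, …, n}` is the element
of `Fin n` with value `i - 1`. -/
def pathLap (n : ℕ) : Matrix (Fin n) (Fin n) ℝ :=
  (SimpleGraph.pathGraph n).lapMatrix ℝ

/-- `λ_min (L_n + ε e_p e_pᵀ)` for the path graph `P_n`. -/
def pathLamMin (n : ℕ) (ε : ℝ) (p : Fin n) : ℝ :=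
  lamMin (pathLap n + ε • portMatrix {p})

/-- The Fiedler value `λ_2` of the path graph `P_n`, its second smallest Laplacian eigenvalue. -/
def pathFiedlerValue (n : ℕ) (hn : 1 < n) : ℝ :=
  eigAsc (isHermitian_lapMatrix (SimpleGraph.pathGraph n))
    ⟨1, by rw [Fintype.card_fin]; exact hn⟩

/-- The explicit cosine sum
`∑_{j=2}^n cos²(π(j-1)/2) / (sin²(π(j-1)/(2n)) ∑_{i=1}^n cos²(π(j-1)(i-1/2)/n))`. -/
def cosineSum (n : ℕ) : ℝ :=
  ∑ j ∈ Finset.Icc 2 n, Real.cos (Real.pi * ((j : ℝ) - 1) / 2) ^ 2 /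
    (Real.sin ((1 / 2) * Real.pi * ((j : ℝ) - 1) / n) ^ 2 *
      ∑ i ∈ Finset.Icc 1 n, Real.cos (Real.pi * ((j : ℝ) - 1) * ((i : ℝ) - 1 / 2) / n) ^ 2)

end PathCenter

end

/-! All but two of the claims reduce to one number, the diagonal entry of the pseudo-inverse of `L`
at `p`. If `L g = e_p - 1/n`, this entry is `γ_p = g(p) - mean(g)`, and pairing the eigenvalue
equation with `1` and with `g` gives `λ_min(L + ε e_p e_pᵀ) = ε/n - (γ_p/n) ε² + O(ε³)`
(`agreeUpToSecondOrder_lamMin`). On the path, `g` is a parabola minus a kink, so `γ_p` is a constant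
plus the squared distance of `p` from the middle, divided by `n` (`pathGreen_self_sub_mean`). Hence
the centre wins at second order for either sign of `ε`. The cosine sum is `4 γ_p` at the centre,
expanded in the eigenvectors of `L`. MPLSE is the case `-ε`; MSup-LE is the case `-ε/τ`, since `Z +
εE = I - τ (L - (ε/τ) E)`.

MSub-LE is not perturbative. Deleting `p` cuts the path into two pieces clamped at one end, and the
longer one carries the smaller Dirichlet eigenvalue. The centre balances the pieces; there a
positive eigenvector bounds `λ_max` from above, while at any other node the longer piece gives a
strictly larger lower bound (`lamMax_removeNodes_lt`).

The Fiedler eigenspace is spanned by half a period of a cosine, which vanishes only in the middle.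
-/

namespace PathCenter

/-! ### Extreme eigenvalues of real symmetric matrices. -/

section Spectrum

variable {V : Type*} [Fintype V] [DecidableEq V]

theorem mem_spectrum_iff_exists_mulVec {A : Matrix V V ℝ} {μ : ℝ} :
    μ ∈ spectrum ℝ A ↔ ∃ v : V → ℝ, v ≠ 0 ∧ A *ᵥ v = μ • v := by
  rw [← Matrix.spectrum_toLin', ← Module.End.hasEigenvalue_iff_mem_spectrum]
  constructor
  · intro h
    obtain ⟨v, hv⟩ := h.exists_hasEigenvector
    exact ⟨v, hv.2, by simpa using hv.apply_eq_smul⟩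
  · rintro ⟨v, hv, h⟩
    exact Module.End.hasEigenvalue_of_hasEigenvector
      (Module.End.hasEigenvector_iff.2
        ⟨Module.End.mem_eigenspace_iff.2 (by simpa using h), hv⟩)

theorem dotProduct_self_pos_of_ne_zero {V : Type*} [Fintype V] {v : V → ℝ} (hv : v ≠ 0) : 0 < v ⬝ᵥ v := by
  have h : 0 ≤ v ⬝ᵥ v := Finset.sum_nonneg fun i _ => mul_self_nonneg _
  exact lt_of_le_of_ne h fun h' => hv (dotProduct_self_eq_zero.1 h'.symm)

theorem mulVec_dotProduct_of_isHermitian {V : Type*} [Fintype V] {A : Matrix V V ℝ} (hA : A.IsHermitian) (x y : V → ℝ) :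
    A *ᵥ x ⬝ᵥ y = x ⬝ᵥ A *ᵥ y := by
  have hT : Aᵀ = A := by
    rw [Matrix.IsHermitian, Matrix.conjTranspose_eq_transpose_of_trivial] at hA
    exact hA
  rw [Matrix.dotProduct_mulVec, ← Matrix.mulVec_transpose, hT]

theorem dotProduct_eq_zero_of_eigenvectors {V : Type*} [Fintype V] {A : Matrix V V ℝ} (hA : A.IsHermitian)
    {x y : V → ℝ} {a b : ℝ} (hx : A *ᵥ x = a • x) (hy : A *ᵥ y = b • y) (hab : a ≠ b) :
    x ⬝ᵥ y = 0 := by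
  have h := mulVec_dotProduct_of_isHermitian hA x y
  rw [hx, hy, smul_dotProduct, dotProduct_smul, smul_eq_mul, smul_eq_mul] at h
  have h' : (a - b) * (x ⬝ᵥ y) = 0 := by linarith
  exact (mul_eq_zero.1 h').resolve_left (sub_ne_zero.2 hab)

theorem lamMin_mul_dotProduct_le [Nonempty V] {A : Matrix V V ℝ} (hA : A.IsHermitian)
    (x : V → ℝ) : lamMin A * (x ⬝ᵥ x) ≤ x ⬝ᵥ A *ᵥ x := by
  have hH : (A - lamMin A • 1).IsHermitian := by
    refine hA.sub ?_
    rw [Matrix.IsHermitian, Matrix.conjTranspose_smul, Matrix.conjTranspose_one]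
    simp
  have hP : (A - lamMin A • 1).PosSemidef := by
    rw [Matrix.posSemidef_iff_isHermitian_and_spectrum_nonneg]
    refine ⟨hH, fun μ hμ => ?_⟩
    obtain ⟨v, hv, h⟩ := mem_spectrum_iff_exists_mulVec.1 hμ
    have : μ + lamMin A ∈ spectrum ℝ A := by
      refine mem_spectrum_iff_exists_mulVec.2 ⟨v, hv, ?_⟩
      rw [Matrix.sub_mulVec, Matrix.smul_mulVec, Matrix.one_mulVec, sub_eq_iff_eq_add] at h
      rw [h, add_smul]
    have := (isLeast_lamMin hA).2 this
    show 0 ≤ μ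
    linarith
  have := hP.dotProduct_mulVec_nonneg x
  rw [Matrix.sub_mulVec, Matrix.smul_mulVec, Matrix.one_mulVec, dotProduct_sub,
    dotProduct_smul] at this
  simpa using this

theorem lamMax_one_sub_smul [Nonempty V] {A : Matrix V V ℝ} (hA : A.IsHermitian) {τ : ℝ}
    (hτ : 0 < τ) : lamMax (1 - τ • A) = 1 - τ * lamMin A := by
  have h1 : (1 - τ • A).IsHermitian := by
    refine Matrix.isHermitian_one.sub ?_
    rw [Matrix.IsHermitian, Matrix.conjTranspose_smul, hA.eq]
    simp
  refine (isGreatest_lamMax h1).unique ⟨?_, fun ν hν => ?_⟩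
  · obtain ⟨v, hv, h⟩ := mem_spectrum_iff_exists_mulVec.1 (isLeast_lamMin hA).1
    refine mem_spectrum_iff_exists_mulVec.2 ⟨v, hv, ?_⟩
    rw [Matrix.sub_mulVec, Matrix.smul_mulVec, Matrix.one_mulVec, h, sub_smul, one_smul, smul_smul]
  · obtain ⟨v, hv, h⟩ := mem_spectrum_iff_exists_mulVec.1 hν
    have : (1 - ν) / τ ∈ spectrum ℝ A := by
      refine mem_spectrum_iff_exists_mulVec.2 ⟨v, hv, ?_⟩
      rw [Matrix.sub_mulVec, Matrix.smul_mulVec, Matrix.one_mulVec] at h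
      have h' : τ • (A *ᵥ v) = (1 - ν) • v := by rw [sub_smul, one_smul, ← h]; abel
      rw [div_eq_inv_mul, mul_smul, ← h', smul_smul, inv_mul_cancel₀ hτ.ne', one_smul]
    have := (isLeast_lamMin hA).2 this
    rw [le_div_iff₀ hτ] at this
    linarith

/-- A nonnegative matrix with a positive vector `x` such that `A x = ρ x` has
`λ_max ≤ ρ`. -/
theorem lamMax_le_of_pos_eigenvector [Nonempty V] {A : Matrix V V ℝ} (hA : A.IsHermitian)
    (hnn : ∀ i j, 0 ≤ A i j) {x : V → ℝ} (hx : ∀ i, 0 < x i) {ρ : ℝ} (h : A *ᵥ x = ρ • x) :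
    lamMax A ≤ ρ := by
  obtain ⟨y, hy, hAy⟩ := mem_spectrum_iff_exists_mulVec.1 (isGreatest_lamMax hA).1
  set ν := lamMax A
  obtain ⟨k, hk⟩ := Function.ne_iff.1 hy
  -- For a top eigenvector `y`, nonnegativity of `A` gives `ν |y| ≤ A |y|` entrywise. Pairing with
  -- `x` and moving `A` across by symmetry yields `ν ≤ ρ`.
  have hpos : 0 < x ⬝ᵥ fun i => |y i| :=
    Finset.sum_pos' (fun i _ => mul_nonneg (hx i).le (abs_nonneg _))
      ⟨k, Finset.mem_univ _, mul_pos (hx k) (abs_pos.2 hk)⟩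
  have hle : ∀ i, ν * |y i| ≤ (A *ᵥ fun i => |y i|) i := fun i => by
    have h1 : ν * y i = ∑ j, A i j * y j := (congrFun hAy i).symm
    calc ν * |y i| ≤ |ν| * |y i| := mul_le_mul_of_nonneg_right (le_abs_self _) (abs_nonneg _)
      _ = |∑ j, A i j * y j| := by rw [← abs_mul, h1]
      _ ≤ ∑ j, |A i j * y j| := Finset.abs_sum_le_sum_abs _ _
      _ = ∑ j, A i j * |y j| := Finset.sum_congr rfl fun j _ => by
        rw [abs_mul, abs_of_nonneg (hnn i j)]
  have h2 : ν * (x ⬝ᵥ fun i => |y i|) ≤ ρ * (x ⬝ᵥ fun i => |y i|) :=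
    calc ν * (x ⬝ᵥ fun i => |y i|) = ∑ i, x i * (ν * |y i|) := by
          rw [dotProduct, Finset.mul_sum]
          exact Finset.sum_congr rfl fun i _ => by ring
      _ ≤ x ⬝ᵥ (A *ᵥ fun i => |y i|) :=
          Finset.sum_le_sum fun i _ => mul_le_mul_of_nonneg_left (hle i) (hx i).le
      _ = ρ * (x ⬝ᵥ fun i => |y i|) := by
          rw [← mulVec_dotProduct_of_isHermitian hA, h, smul_dotProduct, smul_eq_mul]
  exact le_of_mul_le_mul_right h2 hpos

theorem portMatrix_singleton_mulVec (p : V) (v : V → ℝ) :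
    portMatrix {p} *ᵥ v = Pi.single p (v p) := by
  simp [portMatrix, Matrix.single_mulVec, Pi.single]

theorem isHermitian_portMatrix_singleton {V : Type*} [DecidableEq V] (p : V) : (portMatrix {p}).IsHermitian := by
  simp [portMatrix, Matrix.IsHermitian]

theorem isHermitian_add_smul_portMatrix {V : Type*} [DecidableEq V]
    {A : Matrix V V ℝ} (hA : A.IsHermitian) (ε : ℝ) (p : V) :
    (A + ε • portMatrix {p}).IsHermitian := by
  refine hA.add ?_
  rw [Matrix.IsHermitian, Matrix.conjTranspose_smul, (isHermitian_portMatrix_singleton p).eq]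
  simp

end Spectrum

/-! ### Second-order expansion under a rank-one diagonal perturbation. -/

section Perturbation

variable {V : Type*} [Fintype V] [DecidableEq V]

/-- An a priori bound for the expansion. From below, `L` is positive semidefinite and `v p ^ 2 ≤ v
⬝ᵥ v`; from above, the test vector `1` has Rayleigh quotient `ε / |V|`. -/
theorem abs_lamMin_add_smul_portMatrix_le [Nonempty V] {L : Matrix V V ℝ} (hL : L.PosSemidef)
    (hL1 : L *ᵥ (fun _ => 1) = 0) (ε : ℝ) (p : V) :
    |lamMin (L + ε • portMatrix {p})| ≤ |ε| := by
  have hA := isHermitian_add_smul_portMatrix hL.isHermitian ε p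
  set A := L + ε • portMatrix {p}
  have hcard : (1 : ℝ) ≤ Fintype.card V := by exact_mod_cast Fintype.card_pos
  rw [abs_le]
  constructor
  · obtain ⟨v, hv, h⟩ := mem_spectrum_iff_exists_mulVec.1 (isLeast_lamMin hA).1
    have hvv := dotProduct_self_pos_of_ne_zero hv
    have h1 : v ⬝ᵥ A *ᵥ v = lamMin A * (v ⬝ᵥ v) := by rw [h, dotProduct_smul, smul_eq_mul]
    have h2 : v ⬝ᵥ A *ᵥ v = v ⬝ᵥ L *ᵥ v + ε * (v p * v p) := by
      simp only [A, Matrix.add_mulVec, Matrix.smul_mulVec, portMatrix_singleton_mulVec,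
        dotProduct_add, dotProduct_smul, dotProduct_single, smul_eq_mul]
    have h3 : 0 ≤ v ⬝ᵥ L *ᵥ v := by simpa using hL.dotProduct_mulVec_nonneg v
    have h4 : v p * v p ≤ v ⬝ᵥ v :=
      Finset.single_le_sum (f := fun i => v i * v i) (fun i _ => mul_self_nonneg _)
        (Finset.mem_univ p)
    have h5 : -|ε| * (v ⬝ᵥ v) ≤ ε * (v p * v p) := by
      have := mul_le_mul_of_nonneg_left h4 (abs_nonneg ε)
      have := mul_le_mul_of_nonneg_right (neg_abs_le ε) (mul_self_nonneg (v p))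
      linarith
    refine le_of_mul_le_mul_right ?_ hvv
    linarith
  · have h := lamMin_mul_dotProduct_le hA (fun _ => 1)
    have h2 : (fun _ : V => (1 : ℝ)) ⬝ᵥ A *ᵥ (fun _ => 1) = ε := by
      simp only [A, Matrix.add_mulVec, Matrix.smul_mulVec, portMatrix_singleton_mulVec,
        dotProduct_add, dotProduct_smul, dotProduct_single, smul_eq_mul, hL1, dotProduct_zero]
      ring
    have h3 : (fun _ : V => (1 : ℝ)) ⬝ᵥ (fun _ => 1) = Fintype.card V := by
      simp [dotProduct]
    rw [h2, h3] at h
    rcases le_or_gt (lamMin A) 0 with h0 | h0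
    · exact h0.trans (abs_nonneg _)
    · nlinarith [le_abs_self ε]

/-- Second-order expansion of the smallest eigenvalue of `L + ε e_p e_pᵀ`, where `g q` solves
`L g_q = e_q - 1/|V|`. -/
theorem agreeUpToSecondOrder_lamMin [Nonempty V] {L : Matrix V V ℝ} (hL : L.PosSemidef)
    (hL1 : L *ᵥ (fun _ => 1) = 0) (g : V → V → ℝ)
    (hg : ∀ q, L *ᵥ g q = Pi.single q 1 - fun _ => (1 / Fintype.card V : ℝ)) (p : V) :
    AgreeUpToSecondOrder (fun ε => lamMin (L + ε • portMatrix {p}))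
      (fun ε => ε / Fintype.card V +
        -((g p p - (∑ i, g p i) / Fintype.card V) / Fintype.card V) * ε ^ 2) := by
  set N : ℝ := (Fintype.card V : ℝ)
  have hN : (1 : ℝ) ≤ N := by
    exact Nat.one_le_cast.2 Fintype.card_pos
  have hN0 : N ≠ 0 := by positivity
  obtain ⟨K, hK1, hK⟩ : ∃ K : ℝ, 1 ≤ K ∧ ∀ q, ∑ i, |g q i| ≤ K := by
    refine ⟨1 + ∑ q, ∑ i, |g q i|, ?_, fun q => ?_⟩
    · have : 0 ≤ ∑ q, ∑ i, |g q i| :=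
        Finset.sum_nonneg fun q _ => Finset.sum_nonneg fun i _ => abs_nonneg _
      linarith
    · have := Finset.single_le_sum (f := fun q => ∑ i, |g q i|)
        (fun q _ => Finset.sum_nonneg fun i _ => abs_nonneg _) (Finset.mem_univ q)
      linarith
  set γ := g p p - (∑ i, g p i) / N with hγ
  have hKg : ∀ q i, |g q i| ≤ K := fun q i =>
    (Finset.single_le_sum (f := fun i => |g q i|) (fun _ _ => abs_nonneg _)
      (Finset.mem_univ i)).trans (hK q)
  have hdot : ∀ q (v : V → ℝ) (M : ℝ), (∀ i, |v i| ≤ M) → |v ⬝ᵥ g q| ≤ M * K := by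
    intro q v M hM
    have hM0 : 0 ≤ M := (abs_nonneg _).trans (hM p)
    calc |v ⬝ᵥ g q| ≤ ∑ i, |v i * g q i| := Finset.abs_sum_le_sum_abs _ _
      _ ≤ ∑ i, M * |g q i| := Finset.sum_le_sum fun i _ => by
          rw [abs_mul]; exact mul_le_mul_of_nonneg_right (hM i) (abs_nonneg _)
      _ = M * ∑ i, |g q i| := by rw [Finset.mul_sum]
      _ ≤ M * K := mul_le_mul_of_nonneg_left (hK q) hM0
  -- An exact scalar equation for the eigenvalue with a remainder `r = O(ε)`; no differentiability
  -- of eigenvalues is needed.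
  have key : ∀ ε : ℝ, |ε| ≤ 1 / (4 * K) → ∃ r : ℝ, |r| ≤ 4 * K ^ 2 * |ε| ∧
      lamMin (L + ε • portMatrix {p}) * (1 + ε * γ) - ε * lamMin (L + ε • portMatrix {p}) * r =
        ε / N := by
    intro ε hε
    have hA := isHermitian_add_smul_portMatrix hL.isHermitian ε p
    have hlam := abs_lamMin_add_smul_portMatrix_le hL hL1 ε p
    obtain ⟨v, hv, h⟩ := mem_spectrum_iff_exists_mulVec.1 (isLeast_lamMin hA).1
    set lam := lamMin (L + ε • portMatrix {p})
    rw [Matrix.add_mulVec, Matrix.smul_mulVec, portMatrix_singleton_mulVec] at h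
    have hLv : L *ᵥ v = lam • v - ε • Pi.single p (v p) := eq_sub_of_add_eq h
    set s := ∑ i, v i
    obtain ⟨k, -, hkmax⟩ := Finset.exists_max_image Finset.univ (fun i => |v i|)
      ⟨p, Finset.mem_univ p⟩
    set M := |v k|
    have hM : ∀ i, |v i| ≤ M := fun i => hkmax i (Finset.mem_univ i)
    have hM0 : 0 < M := by
      obtain ⟨i, hi⟩ := Function.ne_iff.1 hv
      exact (abs_pos.2 hi).trans_le (hM i)
    -- Pairing the eigenvalue equation with `1`, which lies in the kernel of `L`.
    have hs : ε * v p = lam * s := by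
      have h1 : (fun _ : V => (1 : ℝ)) ⬝ᵥ L *ᵥ v = 0 := by
        rw [← mulVec_dotProduct_of_isHermitian hL.isHermitian, hL1, zero_dotProduct]
      rw [hLv, dotProduct_sub, dotProduct_smul, dotProduct_smul, dotProduct_single] at h1
      have h2 : (fun _ : V => (1 : ℝ)) ⬝ᵥ v = s := by simp [dotProduct, s]
      rw [h2, smul_eq_mul, smul_eq_mul] at h1
      linarith
    -- Pairing with `g q` recovers the deviation of `v q` from the mean, which is therefore `O(ε)`.
    have hw : ∀ q, v q - s / N = lam * (v ⬝ᵥ g q) - ε * v p * g q p := by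
      intro q
      have h1 := mulVec_dotProduct_of_isHermitian hL.isHermitian v (g q)
      rw [hLv, hg, sub_dotProduct, smul_dotProduct, smul_dotProduct, single_dotProduct,
        dotProduct_sub, dotProduct_single] at h1
      have h2 : (v ⬝ᵥ fun _ : V => (1 / N : ℝ)) = s / N := by
        simp only [dotProduct, s, ← Finset.sum_mul]; ring
      rw [h2, smul_eq_mul, smul_eq_mul] at h1
      linarith
    have hwb : ∀ q, |v q - s / N| ≤ 2 * K * |ε| * M := by
      intro q
      rw [hw q]
      have h1 : |lam * (v ⬝ᵥ g q)| ≤ |ε| * (M * K) := by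
        rw [abs_mul]
        exact mul_le_mul hlam (hdot q v M hM) (abs_nonneg _) (abs_nonneg _)
      have h2 : |ε * v p * g q p| ≤ |ε| * M * K := by
        rw [abs_mul, abs_mul]
        exact mul_le_mul (mul_le_mul_of_nonneg_left (hM p) (abs_nonneg _)) (hKg q p)
          (abs_nonneg _) (mul_nonneg (abs_nonneg _) hM0.le)
      calc _ ≤ |lam * (v ⬝ᵥ g q)| + |ε * v p * g q p| := abs_sub _ _
        _ ≤ _ := by linarith
    have hε' : 4 * K * |ε| ≤ 1 := by
      rw [le_div_iff₀ (by positivity)] at hε; linarith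
    -- The deviation is at most `M / 2` by the choice of `1 / (4 * K)`, so the mean cannot vanish
    -- and one may divide by `s`.
    have hsM : M ≤ 2 * |s / N| := by
      have h1 := hwb k
      have h2 : M ≤ |v k - s / N| + |s / N| := by
        have := abs_add_le (v k - s / N) (s / N)
        rwa [sub_add_cancel] at this
      nlinarith
    have hs0 : s ≠ 0 := by
      intro h0
      rw [h0] at hsM
      simp at hsM
      linarith
    set w : V → ℝ := fun q => v q - s / N with hwdef
    have hvw : v ⬝ᵥ g p = w ⬝ᵥ g p + s / N * ∑ i, g p i := by
      simp only [dotProduct, hwdef, sub_mul, Finset.sum_sub_distrib, Finset.mul_sum]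
      ring
    refine ⟨(w ⬝ᵥ g p) / s, ?_, ?_⟩
    · rw [abs_div, div_le_iff₀ (abs_pos.2 hs0)]
      have h1 := hdot p w _ hwb
      have h2 : |s / N| ≤ |s| := by
        rw [abs_div, abs_of_pos (by positivity : 0 < N)]
        exact div_le_self (abs_nonneg _) hN
      calc _ ≤ 2 * K * |ε| * M * K := h1
        _ ≤ 2 * K * |ε| * (2 * |s|) * K := by gcongr; linarith
        _ = _ := by ring
    · have h1 := hw p
      rw [hvw] at h1
      have h2 : lam * s * (1 + ε * γ) - ε * lam * (w ⬝ᵥ g p) = ε / N * s := by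
        have h3 : v p * (1 + ε * g p p) = s / N + lam * (w ⬝ᵥ g p + s / N * ∑ i, g p i) := by
          linarith
        have h4 : ε * v p * (1 + ε * g p p) =
            ε * (s / N) + ε * lam * (w ⬝ᵥ g p + s / N * ∑ i, g p i) := by
          rw [mul_assoc, h3]; ring
        rw [hs] at h4
        rw [hγ]
        linear_combination h4
      have h3 : (w ⬝ᵥ g p) / s * s = w ⬝ᵥ g p := div_mul_cancel₀ _ hs0
      refine mul_right_cancel₀ hs0 ?_
      linear_combination h2 - ε * lam * h3
  refine IsBigO.of_bound (4 * K ^ 2 * (1 + |γ|) + γ ^ 2) ?_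
  have hnhds : ∀ᶠ ε : ℝ in 𝓝 0, |ε| ≤ 1 / (4 * K) := by
    have := Metric.closedBall_mem_nhds (0 : ℝ) (by positivity : (0 : ℝ) < 1 / (4 * K))
    filter_upwards [this] with ε hε
    simpa using hε
  filter_upwards [hnhds] with ε hε
  obtain ⟨r, hr, h⟩ := key ε hε
  have hlam := abs_lamMin_add_smul_portMatrix_le hL hL1 ε p
  set lam := lamMin (L + ε • portMatrix {p})
  have hε1 : |ε| ≤ 1 := hε.trans (by rw [div_le_one (by positivity)]; linarith)
  -- Multiplying `key` by `1 - ε γ` inverts `1 + ε γ` up to `ε² γ²`. Both error terms are cubic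
  -- because `lam` and `r` are `O(ε)`.
  have hid : lam - (ε / N + -(γ / N) * ε ^ 2) = ε * lam * r * (1 - ε * γ) + lam * ε ^ 2 * γ ^ 2 := by
    have h' : lam * (1 + ε * γ) * (1 - ε * γ) - ε * lam * r * (1 - ε * γ) =
        ε / N * (1 - ε * γ) := by rw [← h]; ring
    linear_combination h'
  rw [Real.norm_eq_abs, Real.norm_eq_abs, hid, abs_pow]
  have hb : |1 - ε * γ| ≤ 1 + |γ| := by
    have : |ε * γ| ≤ |γ| := by
      rw [abs_mul]; exact mul_le_of_le_one_left (abs_nonneg _) hε1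
    calc _ ≤ |(1 : ℝ)| + |ε * γ| := abs_sub _ _
      _ ≤ _ := by rw [abs_one]; linarith
  calc |ε * lam * r * (1 - ε * γ) + lam * ε ^ 2 * γ ^ 2|
      ≤ |ε * lam * r * (1 - ε * γ)| + |lam * ε ^ 2 * γ ^ 2| := abs_add_le _ _
    _ = |ε| * |lam| * |r| * |1 - ε * γ| + |lam| * |ε| ^ 2 * γ ^ 2 := by
        simp only [abs_mul, abs_pow, sq_abs]
    _ ≤ |ε| * |ε| * (4 * K ^ 2 * |ε|) * (1 + |γ|) + |ε| * |ε| ^ 2 * γ ^ 2 := by gcongr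
    _ = _ := by ring

end Perturbation

/-! ### The path Laplacian as a second difference. -/

section PathLaplacian

theorem pathLap_mulVec_eq_sum {n : ℕ} (v : Fin n → ℝ) (i : Fin n) :
    (pathLap n *ᵥ v) i =
      ∑ u : Fin n, if (i : ℕ) + 1 = u ∨ (u : ℕ) + 1 = i then v i - v u else 0 := by
  rw [pathLap, SimpleGraph.lapMatrix_mulVec_apply, ← SimpleGraph.card_neighborFinset_eq_degree,
    ← nsmul_eq_mul, ← Finset.sum_const, ← Finset.sum_sub_distrib, ← Finset.sum_filter]
  refine Finset.sum_congr ?_ fun _ _ => rfl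
  ext u
  simp [SimpleGraph.pathGraph_adj]

theorem pathLap_mulVec_comp_rev {n : ℕ} (v : Fin n → ℝ) (i : Fin n) :
    (pathLap n *ᵥ fun j => v j.rev) i = (pathLap n *ᵥ v) i.rev := by
  rw [pathLap_mulVec_eq_sum, pathLap_mulVec_eq_sum, ← Equiv.sum_comp Fin.revPerm]
  refine Finset.sum_congr rfl fun u _ => ?_
  rw [Fin.revPerm_apply, Fin.rev_rev]
  refine if_congr ?_ rfl rfl
  simp only [Fin.val_rev]
  omega

/-- The path Laplacian acts on the restriction of a function satisfying reflecting boundary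
conditions as the negative second difference. -/
theorem pathLap_mulVec {n : ℕ} (f : ℤ → ℝ) (h0 : f (-1) = f 0) (hn : f n = f (n - 1))
    (i : Fin n) :
    (pathLap n *ᵥ fun j => f (j : ℕ)) i = 2 * f (i : ℕ) - f ((i : ℕ) - 1) - f ((i : ℕ) + 1) := by
  have hi := i.isLt
  have hright : ∑ u : Fin n, (if (i : ℕ) + 1 = u then f (i : ℕ) - f (u : ℕ) else 0) =
      f (i : ℕ) - f ((i : ℕ) + 1) := by
    rw [Fin.sum_univ_eq_sum_range (fun u => if (i : ℕ) + 1 = u then f (i : ℕ) - f (u : ℕ) else 0),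
      Finset.sum_ite_eq]
    split_ifs with h
    · push_cast; rfl
    -- The last node has no right neighbour; the ghost value `f n = f (n - 1)` makes the missing
    -- difference zero.
    · rw [Finset.mem_range] at h
      have h' : (n : ℤ) = (i : ℕ) + 1 := by omega
      rw [h', add_sub_cancel_right] at hn
      rw [hn, sub_self]
  have hleft : ∑ u : Fin n, (if (u : ℕ) + 1 = i then f (i : ℕ) - f (u : ℕ) else 0) =
      f (i : ℕ) - f ((i : ℕ) - 1) := by
    rw [Fin.sum_univ_eq_sum_range (fun u => if u + 1 = (i : ℕ) then f (i : ℕ) - f (u : ℕ) else 0)]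
    rcases Nat.eq_zero_or_pos (i : ℕ) with h | h
    · rw [h]; simp [h0]
    · rw [Finset.sum_eq_single ((i : ℕ) - 1)]
      · rw [if_pos (by omega), Nat.cast_sub h]; simp
      · intro b _ hb
        exact if_neg (by omega)
      · intro hb
        exact absurd (Finset.mem_range.2 (by omega)) hb
  rw [pathLap_mulVec_eq_sum]
  have hsplit : ∀ u : Fin n,
      (if (i : ℕ) + 1 = u ∨ (u : ℕ) + 1 = i then f (i : ℕ) - f (u : ℕ) else 0) =
        (if (i : ℕ) + 1 = u then f (i : ℕ) - f (u : ℕ) else 0) +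
          if (u : ℕ) + 1 = i then f (i : ℕ) - f (u : ℕ) else 0 := by
    intro u
    split_ifs <;> first | omega | simp
  rw [Finset.sum_congr rfl fun u _ => hsplit u, Finset.sum_add_distrib, hright, hleft]
  ring

theorem isHermitian_pathLap (n : ℕ) : (pathLap n).IsHermitian :=
  isHermitian_lapMatrix _

theorem posSemidef_pathLap (n : ℕ) : (pathLap n).PosSemidef :=
  SimpleGraph.posSemidef_lapMatrix ℝ _

theorem pathLap_mulVec_const (n : ℕ) : pathLap n *ᵥ (fun _ => 1) = 0 :=
  SimpleGraph.lapMatrix_mulVec_const_eq_zero _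

end PathLaplacian

/-! ### The Green function of the path. -/

section Green

/-- A solution `h_q` of `L h_q = e_q - 1/n`. -/
noncomputable def pathGreen (n : ℕ) (q i : Fin n) : ℝ :=
  (i : ℝ) * (i + 1) / (2 * n) - max ((i : ℝ) - q) 0

/-- The parabola contributes `-1/n` everywhere and the kink a unit mass at `q`. Past `q` the kink
has slope `1`, which cancels the step of the parabola from `n - 1` to `n`, so both ends are
reflecting. -/
theorem pathLap_mulVec_pathGreen {n : ℕ} (q : Fin n) :
    pathLap n *ᵥ pathGreen n q = Pi.single q 1 - fun _ => (1 / n : ℝ) := by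
  have hn : (n : ℝ) ≠ 0 := by
    have := q.isLt
    exact_mod_cast (by omega : n ≠ 0)
  have hq0 : (0 : ℝ) ≤ (q : ℕ) := Nat.cast_nonneg _
  have hqn : ((q : ℕ) : ℝ) + 1 ≤ n := by exact_mod_cast q.isLt
  funext i
  have h := pathLap_mulVec (n := n)
    (fun z => (z : ℝ) * (z + 1) / (2 * n) - max ((z : ℝ) - (q : ℕ)) 0) (by
      push_cast
      rw [max_eq_right (by linarith), max_eq_right (by linarith)]; ring) (by
      push_cast
      rw [max_eq_left (by linarith), max_eq_left (by linarith)]; field_simp; ring) i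
  simp only [Int.cast_natCast] at h
  refine Eq.trans h ?_
  push_cast
  rw [Pi.sub_apply, Pi.single_apply]
  rcases lt_trichotomy i q with hiq | rfl | hiq
  · have h1 : ((i : ℕ) : ℝ) + 1 ≤ (q : ℕ) := by exact_mod_cast hiq
    rw [if_neg hiq.ne, max_eq_right (by linarith), max_eq_right (by linarith),
      max_eq_right (by linarith)]
    field_simp; ring
  · rw [if_pos rfl, max_eq_right (by linarith), max_eq_right (by linarith),
      max_eq_left (by linarith)]
    field_simp; ring
  · have h1 : ((q : ℕ) : ℝ) + 1 ≤ (i : ℕ) := by exact_mod_cast hiq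
    rw [if_neg hiq.ne', max_eq_left (by linarith), max_eq_left (by linarith),
      max_eq_left (by linarith)]
    field_simp; ring

theorem sum_range_max_sub (n q : ℕ) (hq : q < n) :
    ∑ i ∈ Finset.range n, max ((i : ℝ) - q) 0 = (n - 1 - q) * (n - q) / 2 := by
  induction n, hq using Nat.le_induction with
  | base =>
    rw [Finset.sum_eq_zero]
    · push_cast; ring
    · intro i hi
      have : (i : ℝ) ≤ q := by exact_mod_cast Nat.lt_succ_iff.1 (Finset.mem_range.1 hi)
      exact max_eq_right (by linarith)
  | succ m hm ih =>
    have : (q : ℝ) ≤ m := by exact_mod_cast (by omega : q ≤ m)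
    rw [Finset.sum_range_succ, ih, max_eq_left (by linarith)]
    push_cast; ring

theorem sum_range_mul_succ (n : ℕ) :
    ∑ i ∈ Finset.range n, (i : ℝ) * (i + 1) = (n - 1) * n * (n + 1) / 3 := by
  induction n with
  | zero => simp
  | succ m ih =>
    rw [Finset.sum_range_succ, ih]
    push_cast; ring

/-- Subtracting the mean removes the free additive constant in `pathGreen`. With nodes counted from
`0`, the square vanishes exactly at the centre `(n - 1) / 2`. -/
theorem pathGreen_self_sub_mean {n : ℕ} (p : Fin n) :
    pathGreen n p p - (∑ i, pathGreen n p i) / n =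
      (((p : ℝ) - (n - 1) / 2) ^ 2 + (n ^ 2 - 1) / 12) / n := by
  have hn : (n : ℝ) ≠ 0 := by
    have := p.isLt
    exact_mod_cast (by omega : n ≠ 0)
  have hsum : ∑ i, pathGreen n p i =
      (n - 1) * n * (n + 1) / 3 / (2 * n) - (n - 1 - (p : ℕ)) * (n - (p : ℕ)) / 2 := by
    simp only [pathGreen]
    rw [Finset.sum_sub_distrib, ← Finset.sum_div,
      Fin.sum_univ_eq_sum_range (fun i => (i : ℝ) * (i + 1)),
      Fin.sum_univ_eq_sum_range (fun i => max ((i : ℝ) - (p : ℕ)) 0),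
      sum_range_max_sub _ _ p.isLt, sum_range_mul_succ]
  rw [hsum, pathGreen, sub_self, max_self]
  field_simp
  ring

end Green

/-! ### Cosine eigenbasis and spectrum of the path. -/

section Modes

/-- The `k`-th eigenvector of the path Laplacian. -/
noncomputable def pathMode (n k : ℕ) (i : Fin n) : ℝ :=
  Real.cos (Real.pi * k * ((i : ℝ) + 1 / 2) / n)

/-- The `k`-th eigenvalue of the path Laplacian. -/
noncomputable def pathEigenvalue (n k : ℕ) : ℝ :=
  2 - 2 * Real.cos (Real.pi * k / n)

theorem two_mul_cos_sub_cos_sub_cos (x θ : ℝ) :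
    2 * Real.cos x - Real.cos (x - θ) - Real.cos (x + θ) =
      (2 - 2 * Real.cos θ) * Real.cos x := by
  rw [Real.cos_sub, Real.cos_add]; ring

/-- The half-integer shift makes the cosine even about `-1/2` and `n - 1/2`, which are the two
reflecting conditions. -/
theorem pathLap_mulVec_pathMode (n k : ℕ) :
    pathLap n *ᵥ pathMode n k = pathEigenvalue n k • pathMode n k := by
  funext i
  have hn : (n : ℝ) ≠ 0 := by
    have := i.isLt
    exact_mod_cast (by omega : n ≠ 0)
  have h := pathLap_mulVec (n := n)
    (fun z => Real.cos (Real.pi * k * ((z : ℝ) + 1 / 2) / n)) (by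
      rw [← Real.cos_neg]; push_cast; congr 1; ring) (by
      rw [← Real.cos_neg, ← Real.cos_add_nat_mul_two_pi _ k]
      congr 1
      push_cast; field_simp; ring) i
  simp only [Int.cast_natCast] at h
  refine Eq.trans h ?_
  rw [Pi.smul_apply, smul_eq_mul, pathEigenvalue, pathMode, ← two_mul_cos_sub_cos_sub_cos]
  push_cast
  congr 3 <;> ring

theorem pathEigenvalue_strictMono {n : ℕ} :
    StrictMono fun k : Fin n => pathEigenvalue n k := by
  intro a b hab
  have hn : (0 : ℝ) < n := by
    have := a.isLt
    exact_mod_cast (by omega : 0 < n)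
  have hab' : ((a : ℕ) : ℝ) < (b : ℕ) := by exact_mod_cast hab
  have hb : ((b : ℕ) : ℝ) ≤ n := by exact_mod_cast b.isLt.le
  have h := Real.cos_lt_cos_of_nonneg_of_le_pi
    (x := Real.pi * (a : ℕ) / n) (y := Real.pi * (b : ℕ) / n) (by positivity)
    (by rw [div_le_iff₀ hn]; exact mul_le_mul_of_nonneg_left hb Real.pi_pos.le)
    (by gcongr)
  simp only [pathEigenvalue]
  linarith

theorem pathMode_zero_pos {n k : ℕ} (hn : 0 < n) (hk : k < n) : 0 < pathMode n k ⟨0, hn⟩ := by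
  have hn' : (0 : ℝ) < n := by exact_mod_cast hn
  have hk' : (k : ℝ) < n := by exact_mod_cast hk
  refine Real.cos_pos_of_mem_Ioo ⟨?_, ?_⟩
  · refine lt_of_lt_of_le (neg_lt_zero.2 Real.pi_div_two_pos) ?_
    positivity
  · rw [div_lt_iff₀ hn']
    have := mul_lt_mul_of_pos_left hk' Real.pi_pos
    push_cast
    linarith

theorem pathMode_dotProduct_self_pos {n : ℕ} (k : Fin n) :
    0 < pathMode n k ⬝ᵥ pathMode n k := by
  have h0 : 0 < n := by have := k.isLt; omega
  refine dotProduct_self_pos_of_ne_zero fun h => ?_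
  have := pathMode_zero_pos h0 k.isLt
  rw [h] at this
  exact lt_irrefl _ this

theorem pathMode_dotProduct_of_ne {n : ℕ} {k l : Fin n} (hkl : k ≠ l) :
    pathMode n k ⬝ᵥ pathMode n l = 0 :=
  dotProduct_eq_zero_of_eigenvectors (isHermitian_pathLap n) (pathLap_mulVec_pathMode n k)
    (pathLap_mulVec_pathMode n l) (pathEigenvalue_strictMono.injective.ne hkl)

/-- Completeness from orthogonality: a one-sided inverse of a square matrix is two-sided. -/
theorem sum_pathMode_mul_pathMode_div {n : ℕ} (i j : Fin n) :
    ∑ k : Fin n, pathMode n k i * pathMode n k j / (pathMode n k ⬝ᵥ pathMode n k) =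
      if i = j then 1 else 0 := by
  let Φ : Matrix (Fin n) (Fin n) ℝ := Matrix.of fun k i => pathMode n k i
  let Ψ : Matrix (Fin n) (Fin n) ℝ :=
    Matrix.of fun i k => pathMode n k i / (pathMode n k ⬝ᵥ pathMode n k)
  have h : Φ * Ψ = 1 := by
    ext k l
    rw [Matrix.mul_apply, Matrix.one_apply]
    have : ∑ i, Φ k i * Ψ i l =
        (pathMode n k ⬝ᵥ pathMode n l) / (pathMode n l ⬝ᵥ pathMode n l) := by
      simp only [Φ, Ψ, Matrix.of_apply]
      rw [show pathMode n k ⬝ᵥ pathMode n l = ∑ i, pathMode n k i * pathMode n l i from rfl,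
        Finset.sum_div]
      exact Finset.sum_congr rfl fun i _ => by ring
    rw [this]
    split_ifs with hkl
    · rw [hkl, div_self (pathMode_dotProduct_self_pos l).ne']
    · rw [pathMode_dotProduct_of_ne hkl, zero_div]
  have h' : Ψ * Φ = 1 := mul_eq_one_comm.1 h
  have h2 := congrFun (congrFun h' i) j
  rw [Matrix.mul_apply, Matrix.one_apply] at h2
  rw [← h2]
  exact Finset.sum_congr rfl fun k _ => by simp only [Φ, Ψ, Matrix.of_apply]; ring

/-- Expansion of a vector in the eigenvectors of the path Laplacian. -/
theorem eq_sum_dotProduct_pathMode {n : ℕ} (v : Fin n → ℝ) (i : Fin n) :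
    v i = ∑ k : Fin n,
      (v ⬝ᵥ pathMode n k) * pathMode n k i / (pathMode n k ⬝ᵥ pathMode n k) := by
  have h1 : v i = ∑ j, v j * if j = i then 1 else 0 := by simp
  rw [h1]
  simp only [← sum_pathMode_mul_pathMode_div, Finset.mul_sum]
  rw [Finset.sum_comm]
  refine Finset.sum_congr rfl fun k _ => ?_
  rw [show v ⬝ᵥ pathMode n k = ∑ i, v i * pathMode n k i from rfl, Finset.sum_mul,
    Finset.sum_div]
  exact Finset.sum_congr rfl fun j _ => by ring

theorem spectrum_pathLap (n : ℕ) :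
    spectrum ℝ (pathLap n) = Set.range fun k : Fin n => pathEigenvalue n k := by
  ext μ
  rw [mem_spectrum_iff_exists_mulVec]
  constructor
  · rintro ⟨v, hv, h⟩
    by_contra hμ
    refine hv (funext fun i => ?_)
    rw [eq_sum_dotProduct_pathMode v i]
    refine Finset.sum_eq_zero fun k _ => ?_
    rw [dotProduct_eq_zero_of_eigenvectors (isHermitian_pathLap n) h (pathLap_mulVec_pathMode n k)
      fun h' => hμ ⟨k, h'.symm⟩]
    ring
  · rintro ⟨k, rfl⟩
    exact ⟨pathMode n k, fun h => (pathMode_dotProduct_self_pos k).ne' (by rw [h]; simp),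
      pathLap_mulVec_pathMode n k⟩

theorem eq_smul_pathMode {n : ℕ} {v : Fin n → ℝ} {k : Fin n}
    (h : pathLap n *ᵥ v = pathEigenvalue n k • v) : ∃ c : ℝ, ∀ i, v i = c * pathMode n k i := by
  refine ⟨(v ⬝ᵥ pathMode n k) / (pathMode n k ⬝ᵥ pathMode n k), fun i => ?_⟩
  rw [eq_sum_dotProduct_pathMode v i, Finset.sum_eq_single k]
  · ring
  · intro l _ hl
    rw [dotProduct_eq_zero_of_eigenvectors (isHermitian_pathLap n) h (pathLap_mulVec_pathMode n l)
      (pathEigenvalue_strictMono.injective.ne hl.symm)]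
    ring
  · simp

/-- The ascending list of eigenvalues has the `n` distinct values `pathEigenvalue n k` as its range,
so it is strictly increasing. Two strictly increasing lists with the same range agree. -/
theorem pathFiedlerValue_eq (n : ℕ) (hn : 1 < n) : pathFiedlerValue n hn = pathEigenvalue n 1 := by
  set hA := isHermitian_lapMatrix (SimpleGraph.pathGraph n)
  set c := finCongr (Fintype.card_fin n).symm
  have hrange : Set.range (fun i : Fin n => eigAsc hA (c i)) =
      Set.range fun k : Fin n => pathEigenvalue n k := by
    rw [← spectrum_pathLap, pathLap, hA.spectrum_real_eq_range_eigenvalues]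
    have h1 : (fun i : Fin n => eigAsc hA (c i)) = hA.eigenvalues₀ ∘ (c.trans Fin.revPerm) := rfl
    have h2 : hA.eigenvalues = hA.eigenvalues₀ ∘
      (Fintype.equivOfCardEq (Fintype.card_fin _)).symm := rfl
    rw [h1, h2, (Equiv.surjective _).range_comp, (Equiv.surjective _).range_comp]
  have hmono : Monotone fun i : Fin n => eigAsc hA (c i) := fun a b hab =>
    hA.eigenvalues₀_antitone (Fin.rev_le_rev.2 hab)
  have hinj : Function.Injective fun i : Fin n => eigAsc hA (c i) := by
    rw [← Set.injOn_univ, ← Finset.coe_univ, ← Finset.card_image_iff]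
    have h1 : Finset.univ.image (fun i : Fin n => eigAsc hA (c i)) =
        Finset.univ.image fun k : Fin n => pathEigenvalue n k := by
      apply Finset.coe_injective
      simpa using hrange
    rw [h1, Finset.card_image_of_injective _ pathEigenvalue_strictMono.injective]
  exact congrFun (((hmono.strictMono_of_injective hinj).range_inj
    pathEigenvalue_strictMono).1 hrange) ⟨1, hn⟩

end Modes

/-! ### The cosine sum as a spectral expansion. -/

section CosineSum

theorem pathMode_zero {n : ℕ} (i : Fin n) : pathMode n 0 i = 1 := by
  simp [pathMode]

/-- Pairing `L g = e_p - 1/n` with a nonconstant mode gives the coefficient of the centred `g` as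
the mode's value at `p` over its eigenvalue. -/
theorem pathGreen_self_sub_mean_eq_sum {n : ℕ} (p : Fin n) :
    pathGreen n p p - (∑ i, pathGreen n p i) / n =
      ∑ k : Fin n, pathMode n k p ^ 2 /
        (pathEigenvalue n k * (pathMode n k ⬝ᵥ pathMode n k)) := by
  have h0 : 0 < n := by have := p.isLt; omega
  have hn : (n : ℝ) ≠ 0 := by exact_mod_cast h0.ne'
  set m := (∑ i, pathGreen n p i) / n with hm
  set g : Fin n → ℝ := pathGreen n p - m • fun _ => 1 with hgdef
  have hLg : pathLap n *ᵥ g = Pi.single p 1 - fun _ => (1 / n : ℝ) := by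
    rw [hgdef, Matrix.mulVec_sub, Matrix.mulVec_smul, pathLap_mulVec_const, smul_zero, sub_zero,
      pathLap_mulVec_pathGreen]
  have hgp : pathGreen n p p - m = g p := by simp [hgdef]
  rw [hgp, eq_sum_dotProduct_pathMode g p]
  refine Finset.sum_congr rfl fun k _ => ?_
  by_cases hk : k = ⟨0, h0⟩
  -- The constant mode drops out on both sides: `g` has mean zero, and division by the eigenvalue
  -- `0` gives `0`.
  · have hsum : g ⬝ᵥ pathMode n k = 0 := by
      subst hk
      simp only [dotProduct, pathMode_zero, mul_one, hgdef, Pi.sub_apply, Pi.smul_apply,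
        smul_eq_mul, Finset.sum_sub_distrib, Finset.sum_const, Finset.card_univ, Fintype.card_fin,
        nsmul_eq_mul, hm]
      field_simp
      ring
    have hev : pathEigenvalue n k = 0 := by subst hk; simp [pathEigenvalue]
    rw [hsum, hev]; simp
  · have hev : pathEigenvalue n k ≠ 0 := by
      have h1 : pathEigenvalue n ((⟨0, h0⟩ : Fin n) : ℕ) = 0 := by simp [pathEigenvalue]
      rw [← h1]
      exact pathEigenvalue_strictMono.injective.ne hk
    have horth : (fun _ => (1 / n : ℝ)) ⬝ᵥ pathMode n k = 0 := by
      have h1 := pathMode_dotProduct_of_ne hk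
      simp only [dotProduct, pathMode_zero, mul_one] at h1
      simp only [dotProduct, ← Finset.mul_sum, h1, mul_zero]
    have h2 := mulVec_dotProduct_of_isHermitian (isHermitian_pathLap n) g (pathMode n k)
    rw [hLg, pathLap_mulVec_pathMode, sub_dotProduct, horth, single_dotProduct, dotProduct_smul,
      smul_eq_mul, one_mul, sub_zero] at h2
    have hN := (pathMode_dotProduct_self_pos k).ne'
    rw [div_eq_div_iff hN (mul_ne_zero hev hN)]
    linear_combination -(pathMode n k p * (pathMode n k ⬝ᵥ pathMode n k)) * h2

theorem sum_Icc_one_eq_sum_fin (f : ℕ → ℝ) (n : ℕ) :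
    ∑ j ∈ Finset.Icc 1 n, f j = ∑ k : Fin n, f (k + 1) := by
  rw [Fin.sum_univ_eq_sum_range (fun k => f (k + 1)), Finset.range_eq_Ico, Finset.sum_Ico_add']
  rfl

theorem pathEigenvalue_eq_four_mul_sin_sq (n k : ℕ) :
    pathEigenvalue n k = 4 * Real.sin ((1 / 2) * Real.pi * k / n) ^ 2 := by
  have h : Real.pi * k / n = 2 * ((1 / 2) * Real.pi * k / n) := by ring
  rw [pathEigenvalue, h, Real.cos_two_mul, Real.cos_sq']
  ring

theorem cosineSum_eq {n : ℕ} (p : Fin n) (hp : ((p : ℕ) : ℝ) + 1 = ((n : ℝ) + 1) / 2) :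
    cosineSum n = 4 * (pathGreen n p p - (∑ i, pathGreen n p i) / n) := by
  have h0 : 0 < n := by have := p.isLt; omega
  have hn : (n : ℝ) ≠ 0 := by exact_mod_cast h0.ne'
  set F : ℕ → ℝ := fun j => Real.cos (Real.pi * ((j : ℝ) - 1) / 2) ^ 2 /
    (Real.sin ((1 / 2) * Real.pi * ((j : ℝ) - 1) / n) ^ 2 *
      ∑ i ∈ Finset.Icc 1 n, Real.cos (Real.pi * ((j : ℝ) - 1) * ((i : ℝ) - 1 / 2) / n) ^ 2)
    with hF
  -- The added term `j = 1` has `sin 0` in its denominator, hence is `0`.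
  have h1 : cosineSum n = ∑ j ∈ Finset.Icc 1 n, F j := by
    refine Finset.sum_subset (Finset.Icc_subset_Icc_left (by norm_num)) fun j hj hj' => ?_
    have : j = 1 := by
      simp only [Finset.mem_Icc] at hj hj'
      omega
    subst this
    simp
  rw [h1, sum_Icc_one_eq_sum_fin, pathGreen_self_sub_mean_eq_sum, Finset.mul_sum]
  refine Finset.sum_congr rfl fun k _ => ?_
  have hmode : pathMode n k p = Real.cos (Real.pi * k / 2) := by
    have : ((p : ℕ) : ℝ) + 1 / 2 = n / 2 := by linarith
    rw [pathMode, this]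
    congr 1
    field_simp
  have hdot : ∑ i ∈ Finset.Icc 1 n, Real.cos (Real.pi * k * ((i : ℝ) - 1 / 2) / n) ^ 2 =
      pathMode n k ⬝ᵥ pathMode n k := by
    rw [sum_Icc_one_eq_sum_fin (fun i => Real.cos (Real.pi * k * ((i : ℝ) - 1 / 2) / n) ^ 2)]
    refine Finset.sum_congr rfl fun i _ => ?_
    rw [pathMode, sq]
    push_cast
    rw [show ((i : ℕ) : ℝ) + 1 - 1 / 2 = (i : ℕ) + 1 / 2 by ring]
  simp only [hF, Nat.cast_add, Nat.cast_one, add_sub_cancel_right]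
  rw [hdot, hmode, pathEigenvalue_eq_four_mul_sin_sq, mul_assoc 4, ← mul_div_assoc,
    mul_div_mul_left _ _ (four_ne_zero)]

end CosineSum

/-! ### Deleting a node: Dirichlet eigenvalues of the two pieces. -/

section RemoveNode

/-- The lowest Dirichlet eigenvector of the part of the path to the left of `p`, extended by
zero. -/
noncomputable def leftMode (n : ℕ) (p i : Fin n) : ℝ :=
  if i < p then Real.cos (((i : ℝ) + 1 / 2) * (Real.pi / (2 * p + 1))) else 0

/-- The lowest Dirichlet eigenvalue of a path with `q` nodes, clamped at one end. -/
noncomputable def dirichletEigenvalue (q : ℕ) : ℝ :=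
  2 - 2 * Real.cos (Real.pi / (2 * q + 1))

theorem pathLap_mulVec_leftMode {n : ℕ} {p i : Fin n} (hi : i ≠ p) :
    (pathLap n *ᵥ leftMode n p) i = dirichletEigenvalue p * leftMode n p i := by
  set θ : ℝ := Real.pi / (2 * (p : ℕ) + 1) with hθ
  set f : ℤ → ℝ := fun z => if z < (p : ℕ) then Real.cos (((z : ℝ) + 1 / 2) * θ) else 0 with hf
  -- The frequency is chosen so that the cosine vanishes at `p`. The formula thus also covers the
  -- neighbour `p` of the node `p - 1`.
  have hfp : ∀ z : ℤ, z ≤ (p : ℕ) → f z = Real.cos (((z : ℝ) + 1 / 2) * θ) := by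
    intro z hz
    rcases hz.lt_or_eq with h | h
    · exact if_pos h
    · have h1 : ((z : ℝ) + 1 / 2) * θ = Real.pi / 2 := by
        rw [h, hθ, Int.cast_natCast]
        field_simp
      rw [h1, Real.cos_pi_div_two]
      exact if_neg h.not_lt
  have hf0 : ∀ z : ℤ, (p : ℕ) ≤ z → f z = 0 := fun z hz => if_neg hz.not_gt
  have hfi : ∀ j : Fin n, f (j : ℕ) = leftMode n p j := by
    intro j
    simp only [hf, leftMode, Int.cast_natCast]
    exact if_congr (by rw [Fin.lt_def]; omega) rfl rfl
  have h := pathLap_mulVec (n := n) f (by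
      rw [hfp _ (by omega), hfp _ (by omega), ← Real.cos_neg]
      congr 1
      push_cast; ring) (by
      have := p.isLt
      rw [hf0 _ (by omega), hf0 _ (by omega)]) i
  simp only [hfi] at h
  rw [h]
  rcases lt_or_gt_of_ne hi with h1 | h1
  · have h1' : (i : ℕ) < p := h1
    rw [← hfi, hfp _ (by omega), hfp _ (by omega), hfp _ (by omega), dirichletEigenvalue,
      ← two_mul_cos_sub_cos_sub_cos]
    push_cast
    congr 3 <;> ring
  · have h1' : (p : ℕ) < i := h1
    rw [← hfi, hf0 _ (by omega), hf0 _ (by omega), hf0 _ (by omega)]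
    ring

theorem leftMode_self {n : ℕ} (p : Fin n) : leftMode n p p = 0 :=
  if_neg (lt_irrefl _)

theorem leftMode_pos {n : ℕ} {p i : Fin n} (hi : i < p) : 0 < leftMode n p i := by
  rw [leftMode, if_pos hi]
  have h1 : ((i : ℕ) : ℝ) + 1 ≤ (p : ℕ) := by exact_mod_cast hi
  refine Real.cos_pos_of_mem_Ioo ⟨?_, ?_⟩
  · refine lt_of_lt_of_le (neg_lt_zero.2 Real.pi_div_two_pos) ?_
    positivity
  · rw [← mul_div_assoc, div_lt_div_iff₀ (by positivity) two_pos]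
    nlinarith [Real.pi_pos]

theorem leftMode_nonneg {n : ℕ} (p i : Fin n) : 0 ≤ leftMode n p i := by
  by_cases hi : i < p
  · exact (leftMode_pos hi).le
  · exact (if_neg hi).ge

theorem dirichletEigenvalue_lt {a b : ℕ} (hab : a < b) :
    dirichletEigenvalue b < dirichletEigenvalue a := by
  have hab' : (a : ℝ) < b := by exact_mod_cast hab
  have h := Real.cos_lt_cos_of_nonneg_of_le_pi
    (x := Real.pi / (2 * b + 1)) (y := Real.pi / (2 * a + 1)) (by positivity)
    (div_le_self Real.pi_pos.le (by linarith [(Nat.cast_nonneg a : (0 : ℝ) ≤ a)]))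
    (by gcongr)
  simp only [dirichletEigenvalue]
  linarith

theorem removeNodes_mulVec {V : Type*} [Fintype V] [DecidableEq V] (A : Matrix V V ℝ)
    (S : Finset V) {u : V → ℝ} (hu : ∀ i ∈ S, u i = 0) (i : {i : V // i ∉ S}) :
    (removeNodes A S *ᵥ fun j => u j) i = (A *ᵥ u) i := by
  have h1 : ∑ j ∈ Sᶜ, A i j * u j = ∑ j : {i : V // i ∉ S}, A i j * u j :=
    Finset.sum_subtype _ (fun x => Finset.mem_compl) _
  calc _ = ∑ j : {i : V // i ∉ S}, A i j * u j := rfl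
    _ = ∑ j ∈ Sᶜ, A i j * u j := h1.symm
    _ = ∑ j, A i j * u j := Finset.sum_subset (Finset.subset_univ _) fun j _ hj => by
        rw [hu j (by simpa using hj), mul_zero]

theorem isHermitian_stochMatrix {V : Type*} [Fintype V] [DecidableEq V]
    (G : SimpleGraph V) [DecidableRel G.Adj] (τ : ℝ) : (stochMatrix G τ).IsHermitian := by
  refine Matrix.isHermitian_one.sub ?_
  rw [Matrix.IsHermitian, Matrix.conjTranspose_smul, (isHermitian_lapMatrix G).eq]
  simp

theorem stochMatrix_nonneg {V : Type*} [Fintype V] [DecidableEq V]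
    (G : SimpleGraph V) [DecidableRel G.Adj] {τ : ℝ} (hτ0 : 0 ≤ τ) (hτ : τ * G.maxDegree ≤ 1)
    (i j : V) : 0 ≤ stochMatrix G τ i j := by
  rw [stochMatrix, SimpleGraph.lapMatrix, SimpleGraph.degMatrix, Matrix.sub_apply,
    Matrix.smul_apply, Matrix.sub_apply, SimpleGraph.adjMatrix_apply, Matrix.one_apply,
    Matrix.diagonal_apply, smul_eq_mul]
  by_cases h : i = j
  · subst h
    have h1 : (G.degree i : ℝ) ≤ G.maxDegree := by exact_mod_cast G.degree_le_maxDegree i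
    have h2 := mul_le_mul_of_nonneg_left h1 hτ0
    simp only [if_true, SimpleGraph.irrefl, if_false]
    linarith
  · simp only [h, if_false]
    split_ifs <;> linarith

theorem removeNodes_stochMatrix_mulVec {n : ℕ} (τ : ℝ) {μ : ℝ} {p : Fin n} {u : Fin n → ℝ}
    (hu : u p = 0) (h : ∀ i, i ≠ p → (pathLap n *ᵥ u) i = μ * u i) :
    (removeNodes (stochMatrix (SimpleGraph.pathGraph n) τ) {p} *ᵥ fun j => u j) =
      (1 - τ * μ) • fun j : {i : Fin n // i ∉ ({p} : Finset (Fin n))} => u j := by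
  funext i
  have hi : (i : Fin n) ≠ p := by simpa using i.2
  rw [removeNodes_mulVec _ _ (by simpa using hu), stochMatrix, Matrix.sub_mulVec,
    Matrix.smul_mulVec, Matrix.one_mulVec, Pi.sub_apply, Pi.smul_apply, Pi.smul_apply]
  have := h i hi
  rw [pathLap] at this
  rw [this]
  simp only [smul_eq_mul]
  ring

theorem nonempty_removeNode {n : ℕ} (hn : 1 < n) (p : Fin n) :
    Nonempty {i : Fin n // i ∉ ({p} : Finset (Fin n))} := by
  have : Nontrivial (Fin n) := Fin.nontrivial_iff_two_le.2 hn
  obtain ⟨q, hq⟩ := exists_ne p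
  exact ⟨⟨q, by simpa using hq⟩⟩

/-- Since `u` vanishes at `p`, deleting that column changes nothing, so `u` restricts to an
eigenvector of the reduced matrix. -/
theorem le_lamMax_removeNodes {n : ℕ} (hn : 1 < n) (τ : ℝ) {μ : ℝ} {p i : Fin n}
    {u : Fin n → ℝ} (hu : u p = 0) (hi : u i ≠ 0)
    (h : ∀ i, i ≠ p → (pathLap n *ᵥ u) i = μ * u i) :
    1 - τ * μ ≤ lamMax (removeNodes (stochMatrix (SimpleGraph.pathGraph n) τ) {p}) := by
  have := nonempty_removeNode hn p
  refine (isGreatest_lamMax ((isHermitian_stochMatrix _ τ).submatrix _)).2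
    (mem_spectrum_iff_exists_mulVec.2 ⟨_, ?_, removeNodes_stochMatrix_mulVec τ hu h⟩)
  have hip : i ≠ p := fun hip => hi (hip ▸ hu)
  exact fun h0 => hi (congrFun h0 ⟨i, by simpa using hip⟩)

theorem pathLap_mulVec_leftMode_rev {n : ℕ} {p i : Fin n} (hi : i ≠ p) :
    (pathLap n *ᵥ fun j => leftMode n p.rev j.rev) i =
      dirichletEigenvalue p.rev * leftMode n p.rev i.rev := by
  rw [pathLap_mulVec_comp_rev, pathLap_mulVec_leftMode (Fin.rev_injective.ne hi)]

/-- At the centre the two pieces are mirror images with equal eigenvalues, so the left mode plus its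
reflection is a positive eigenvector. -/
theorem lamMax_removeNodes_le {n : ℕ} (hn : 1 < n) {τ : ℝ} (hτ0 : 0 ≤ τ)
    (hτ : τ * (SimpleGraph.pathGraph n).maxDegree ≤ 1) {p : Fin n} (hp : p.rev = p) :
    lamMax (removeNodes (stochMatrix (SimpleGraph.pathGraph n) τ) {p}) ≤
      1 - τ * dirichletEigenvalue p := by
  have := nonempty_removeNode hn p
  refine lamMax_le_of_pos_eigenvector ((isHermitian_stochMatrix _ τ).submatrix _)
    (fun i j => stochMatrix_nonneg _ hτ0 hτ _ _) (fun i => ?_)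
    (removeNodes_stochMatrix_mulVec τ
      (u := leftMode n p + fun j => leftMode n p.rev j.rev) ?_ fun i hi => ?_)
  · have hi : (i : Fin n) ≠ p := by simpa using i.2
    rw [Pi.add_apply]
    rcases lt_or_gt_of_ne hi with h | h
    · exact add_pos_of_pos_of_nonneg (leftMode_pos h) (leftMode_nonneg _ _)
    · exact add_pos_of_nonneg_of_pos (leftMode_nonneg _ _) (leftMode_pos (Fin.rev_lt_rev.2 h))
  · rw [Pi.add_apply, leftMode_self, leftMode_self, add_zero]
  · rw [Matrix.mulVec_add, Pi.add_apply, Pi.add_apply, pathLap_mulVec_leftMode hi,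
      pathLap_mulVec_leftMode_rev hi, hp]
    ring

/-- Off the centre, one piece has more nodes than each half left by `c`. For `p < c` it is the right
piece, reached by reversing the path. -/
theorem lamMax_removeNodes_lt {n : ℕ} (hn : 1 < n) {τ : ℝ} (hτ0 : 0 < τ)
    (hτ : τ * (SimpleGraph.pathGraph n).maxDegree ≤ 1) {c p : Fin n} (hc : c.rev = c)
    (hp : p ≠ c) :
    lamMax (removeNodes (stochMatrix (SimpleGraph.pathGraph n) τ) {c}) <
      lamMax (removeNodes (stochMatrix (SimpleGraph.pathGraph n) τ) {p}) := by
  refine (lamMax_removeNodes_le hn hτ0.le hτ hc).trans_lt ?_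
  have hstep : ∀ {q : Fin n}, c < q → 1 - τ * dirichletEigenvalue c <
      1 - τ * dirichletEigenvalue q := fun {q} hq => by
    have := mul_lt_mul_of_pos_left (dirichletEigenvalue_lt (Fin.lt_def.1 hq)) hτ0
    linarith
  rcases lt_or_gt_of_ne hp with h | h
  · have h' : c < p.rev := by rw [← hc]; exact Fin.rev_lt_rev.2 h
    exact (hstep h').trans_le (le_lamMax_removeNodes hn τ (i := c.rev)
      (u := fun j => leftMode n p.rev j.rev) (leftMode_self _)
      (by rw [Fin.rev_rev]; exact (leftMode_pos h').ne') fun i hi => pathLap_mulVec_leftMode_rev hi)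
  · exact (hstep h).trans_le (le_lamMax_removeNodes hn τ (leftMode_self _) (leftMode_pos h).ne'
      fun i hi => pathLap_mulVec_leftMode hi)

end RemoveNode

/-! ### The zero of the Fiedler vector. -/

section Fiedler

/-- All arguments lie in `[0, π]`, where cosine is injective, so a zero forces the argument `π / 2`.
-/
theorem pathMode_one_eq_zero_iff {n : ℕ} (c : Fin n)
    (hc : ((c : ℕ) : ℝ) + 1 = ((n : ℝ) + 1) / 2) (j : Fin n) : pathMode n 1 j = 0 ↔ j = c := by
  have h0 : 0 < n := by have := c.isLt; omega
  have hn : (0 : ℝ) < n := by exact_mod_cast h0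
  have hj : ((j : ℕ) : ℝ) + 1 ≤ n := by exact_mod_cast j.isLt
  have hmem : Real.pi * (1 : ℕ) * ((j : ℕ) + 1 / 2) / n ∈ Set.Icc 0 Real.pi := by
    refine ⟨by positivity, ?_⟩
    rw [div_le_iff₀ hn]
    push_cast
    nlinarith [Real.pi_pos]
  have hmem2 : Real.pi / 2 ∈ Set.Icc 0 Real.pi :=
    ⟨by positivity, by linarith [Real.pi_pos]⟩
  rw [pathMode, ← Real.cos_pi_div_two, Real.injOn_cos.eq_iff hmem hmem2, Fin.ext_iff,
    ← @Nat.cast_inj ℝ, div_eq_div_iff hn.ne' two_ne_zero, Nat.cast_one, mul_one, mul_assoc,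
    mul_right_inj' Real.pi_ne_zero]
  constructor <;> intro h <;> linarith

end Fiedler

/-! ### From expansions to strict comparison of nodes. -/

section Asymptotics

/-- The linear terms cancel and `(b' - b) ε²` is positive for both signs of `ε`, dominating the
cubic errors. -/
theorem eventually_lt_of_agreeUpToSecondOrder {f f' : ℝ → ℝ} {a b b' : ℝ}
    (hf : AgreeUpToSecondOrder f fun ε => a * ε + b * ε ^ 2)
    (hf' : AgreeUpToSecondOrder f' fun ε => a * ε + b' * ε ^ 2) (hb : b < b') :
    ∀ᶠ ε in 𝓝[≠] (0 : ℝ), f ε < f' ε := by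
  have ho : (fun ε : ℝ => ε ^ 3) =o[𝓝 0] fun ε => ε ^ 2 :=
    isLittleO_pow_pow (by norm_num)
  have h := (hf.trans_isLittleO ho).sub (hf'.trans_isLittleO ho)
  have hbound := h.bound (half_pos (sub_pos.2 hb))
  filter_upwards [nhdsWithin_le_nhds hbound, self_mem_nhdsWithin] with ε hε hne
  have hsq : 0 < ε ^ 2 := by
    have : ε ≠ 0 := hne
    positivity
  rw [Real.norm_eq_abs, Real.norm_eq_abs, abs_of_pos hsq] at hε
  have := le_of_abs_le hε
  have := mul_pos (sub_pos.2 hb) hsq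
  linarith

theorem tendsto_const_mul_nhdsNE {c : ℝ} (hc : c ≠ 0) :
    Tendsto (fun ε : ℝ => c * ε) (𝓝[≠] 0) (𝓝[≠] 0) := by
  refine tendsto_nhdsWithin_of_tendsto_nhds_of_eventually_within _ ?_ ?_
  · have : Tendsto (fun ε : ℝ => c * ε) (𝓝 0) (𝓝 (c * 0)) :=
      (continuous_const.mul continuous_id).tendsto 0
    rw [mul_zero] at this
    exact this.mono_left nhdsWithin_le_nhds
  · filter_upwards [self_mem_nhdsWithin] with ε hε
    exact mul_ne_zero hc hε

theorem setOf_card_one_minimizer {V : Type*} {F : Finset V → ℝ} {c : V}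
    (h : ∀ p, p ≠ c → F {c} < F {p}) :
    {S : Finset V | S.card = 1 ∧ ∀ T : Finset V, T.card = 1 → F S ≤ F T} = {{c}} := by
  ext S
  simp only [Set.mem_ofPred_eq, Set.mem_singleton_iff]
  constructor
  · rintro ⟨hS, hmin⟩
    obtain ⟨p, rfl⟩ := Finset.card_eq_one.1 hS
    by_contra hp
    exact (h p fun hpc => hp (by rw [hpc])).not_ge (hmin {c} (Finset.card_singleton c))
  · rintro rfl
    refine ⟨Finset.card_singleton c, fun T hT => ?_⟩
    obtain ⟨p, rfl⟩ := Finset.card_eq_one.1 hT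
    by_cases hp : p = c
    · rw [hp]
    · exact (h p hp).le

/-- The second-order coefficient of `λ_min (L + ε e_p e_pᵀ)` for the path. -/
noncomputable def pathCoeff (n : ℕ) (p : Fin n) : ℝ :=
  -((pathGreen n p p - (∑ i, pathGreen n p i) / n) / n)

theorem pathCoeff_lt {n : ℕ} {c p : Fin n} (hc : ((c : ℕ) : ℝ) + 1 = ((n : ℝ) + 1) / 2)
    (hp : p ≠ c) : pathCoeff n p < pathCoeff n c := by
  have h0 : 0 < n := by have := c.isLt; omega
  have hn : (0 : ℝ) < n := by exact_mod_cast h0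
  rw [pathCoeff, pathCoeff, pathGreen_self_sub_mean, pathGreen_self_sub_mean]
  have hc' : ((c : ℕ) : ℝ) - (n - 1) / 2 = 0 := by linarith
  have hp' : ((p : ℕ) : ℝ) - (n - 1) / 2 ≠ 0 := by
    intro h
    refine hp (Fin.ext ?_)
    have : ((p : ℕ) : ℝ) = (c : ℕ) := by linarith
    exact_mod_cast this
  have : 0 < (((p : ℕ) : ℝ) - (n - 1) / 2) ^ 2 := by positivity
  rw [hc', neg_lt_neg_iff]
  refine div_lt_div_of_pos_right (div_lt_div_of_pos_right ?_ hn) hn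
  linarith

theorem agreeUpToSecondOrder_pathLamMin {n : ℕ} (p : Fin n) :
    AgreeUpToSecondOrder (fun ε => pathLamMin n ε p)
      (fun ε => ε / n + pathCoeff n p * ε ^ 2) := by
  have : Nonempty (Fin n) := ⟨p⟩
  have h := agreeUpToSecondOrder_lamMin (posSemidef_pathLap n) (pathLap_mulVec_const n)
    (pathGreen n) (fun q => by rw [pathLap_mulVec_pathGreen, Fintype.card_fin]) p
  simp only [Fintype.card_fin] at h
  exact h

theorem eventually_pathLamMin_lt {n : ℕ} {c : Fin n}
    (hc : ((c : ℕ) : ℝ) + 1 = ((n : ℝ) + 1) / 2) :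
    ∀ᶠ ε in 𝓝[≠] (0 : ℝ), ∀ p, p ≠ c → pathLamMin n ε p < pathLamMin n ε c := by
  rw [eventually_all]
  intro p
  by_cases hp : p = c
  · exact Eventually.of_forall fun _ h => absurd hp h
  have heq : ∀ q : Fin n, (fun ε : ℝ => ε / n + pathCoeff n q * ε ^ 2) =
      fun ε => 1 / n * ε + pathCoeff n q * ε ^ 2 := fun q => by
    funext ε; ring
  have h1 := agreeUpToSecondOrder_pathLamMin p
  have h2 := agreeUpToSecondOrder_pathLamMin c
  rw [heq] at h1 h2
  filter_upwards [eventually_lt_of_agreeUpToSecondOrder h1 h2 (pathCoeff_lt hc hp)] with ε h _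
  exact h

theorem lamMax_stochMatrix_add {n : ℕ} {τ : ℝ} (hτ : 0 < τ) (ε : ℝ) (p : Fin n) :
    lamMax (stochMatrix (SimpleGraph.pathGraph n) τ + ε • portMatrix {p}) =
      1 - τ * pathLamMin n (-τ⁻¹ * ε) p := by
  have : Nonempty (Fin n) := ⟨p⟩
  rw [pathLamMin, ← lamMax_one_sub_smul
    (isHermitian_add_smul_portMatrix (isHermitian_pathLap n) _ p) hτ]
  congr 1
  rw [smul_add, smul_smul, ← mul_assoc, mul_neg, mul_inv_cancel₀ hτ.ne', neg_one_mul, neg_smul,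
    stochMatrix, pathLap]
  abel

end Asymptotics

end PathCenter

/-! ### Assembly of the three parts. -/

open PathCenter in
theorem mainTheorem1 (n : ℕ) (hodd : Odd n) (hn : 1 < n)
    (τ : ℝ) (hτ0 : 0 < τ) (hτ : τ < 1 / ((SimpleGraph.pathGraph n).maxDegree : ℝ))
    (pstar : Fin n) (hpstar : ((pstar : ℕ) : ℝ) + 1 = ((n : ℝ) + 1) / 2) :
    -- Part 1: the smallest eigenvalue of the perturbed Laplacian, up to second order
    ((∃ β : Fin n → ℝ,
        (∀ p, PathCenter.AgreeUpToSecondOrder (fun ε => PathCenter.pathLamMin n ε p)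
          (fun ε => ε / n + β p * ε ^ 2)) ∧
        (∀ p, p ≠ pstar → β p < β pstar)) ∧
      (∀ᶠ ε in 𝓝[≠] (0 : ℝ), ∀ p, p ≠ pstar →
        PathCenter.pathLamMin n ε p < PathCenter.pathLamMin n ε pstar) ∧
      PathCenter.AgreeUpToSecondOrder (fun ε => ⨆ p, PathCenter.pathLamMin n ε p)
        (fun ε => ε / n - ε ^ 2 / (4 * n) * PathCenter.cosineSum n) ∧
      (∀ ε : ℝ, ε / n - ε ^ 2 / (4 * n) * PathCenter.cosineSum n =
        ε / n - ε ^ 2 / (12 * (n : ℝ) ^ 2) * ((n : ℝ) ^ 2 - 1))) ∧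
    -- Part 2: `pstar` is the unique center for all three criteria
    ((∀ᶠ ε in 𝓝[≠] (0 : ℝ),
        PathCenter.mplseSets (SimpleGraph.pathGraph n) ε 1 = {{pstar}}) ∧
      PathCenter.msubSets (SimpleGraph.pathGraph n) τ 1 = {{pstar}} ∧
      (∀ᶠ ε in 𝓝[>] (0 : ℝ),
        PathCenter.msupSets (SimpleGraph.pathGraph n) τ ε 1 = {{pstar}}) ∧
      (∃ γ : Fin n → ℝ,
        (∀ p, PathCenter.AgreeUpToSecondOrder
          (fun ε => PathCenter.lamMax (PathCenter.stochMatrix (SimpleGraph.pathGraph n) τ +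
            ε • PathCenter.portMatrix {p}))
          (fun ε => 1 + ε / n + γ p * ε ^ 2)) ∧
        (∀ p, p ≠ pstar → γ pstar < γ p))) ∧
    -- Part 3: the Fiedler vector vanishes exactly at `pstar`
    (∀ v : Fin n → ℝ, v ≠ 0 →
      PathCenter.pathLap n *ᵥ v = PathCenter.pathFiedlerValue n hn • v →
      ∀ j : Fin n, v j = 0 ↔ j = pstar) := by
  have hn0 : (n : ℝ) ≠ 0 := by exact_mod_cast (by omega : n ≠ 0)
  have : Nonempty (Fin n) := ⟨pstar⟩
  have hlt := eventually_pathLamMin_lt hpstar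
  have hrev : pstar.rev = pstar := by
    refine Fin.ext ?_
    have : 2 * (pstar : ℕ) + 1 = n := by
      have : 2 * ((pstar : ℕ) : ℝ) + 1 = n := by linarith
      exact_mod_cast this
    rw [Fin.val_rev]
    omega
  have hdeg : τ * (SimpleGraph.pathGraph n).maxDegree ≤ 1 := by
    rcases Nat.eq_zero_or_pos (SimpleGraph.pathGraph n).maxDegree with h | h
    · rw [h]; simp
    · rw [lt_div_iff₀ (by exact_mod_cast h)] at hτ
      exact hτ.le
  -- The witness `-(pathCoeff n p / τ)` comes from `-τ β (ε/τ)²`; its sign turns the maximum at the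
  -- centre into a minimum.
  refine ⟨⟨⟨pathCoeff n, agreeUpToSecondOrder_pathLamMin, fun p => pathCoeff_lt hpstar⟩, hlt,
    ?_, fun ε => ?_⟩, ⟨?_, ?_, ?_, fun p => -(pathCoeff n p / τ), fun p => ?_, fun p hp => ?_⟩, ?_⟩
  · have hsup : ∀ᶠ ε in 𝓝 (0 : ℝ), ⨆ p, pathLamMin n ε p = pathLamMin n ε pstar := by
      rw [eventually_nhdsWithin_iff] at hlt
      filter_upwards [hlt] with ε hε
      refine le_antisymm (ciSup_le fun p => ?_) (le_ciSup (Set.finite_range _).bddAbove pstar)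
      by_cases hε0 : ε = 0
      · simp [pathLamMin, hε0]
      · by_cases hp : p = pstar
        · rw [hp]
        · exact (hε hε0 p hp).le
    refine (agreeUpToSecondOrder_pathLamMin pstar).congr' ?_ EventuallyEq.rfl
    filter_upwards [hsup] with ε hε
    rw [hε, cosineSum_eq pstar hpstar, pathCoeff]
    field_simp
    ring
  · have hc : ((pstar : ℕ) : ℝ) - (n - 1) / 2 = 0 := by linarith
    rw [cosineSum_eq pstar hpstar, pathGreen_self_sub_mean, hc]
    field_simp
    ring
  · filter_upwards [(tendsto_const_mul_nhdsNE (neg_ne_zero.2 one_ne_zero)).eventually hlt]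
      with ε hε
    have := setOf_card_one_minimizer
      (F := fun S => -lamMin ((SimpleGraph.pathGraph n).lapMatrix ℝ - ε • portMatrix S))
      (c := pstar) fun p hp => by
        have := hε p hp
        rw [pathLamMin, pathLamMin, neg_one_mul, neg_smul, neg_smul, ← sub_eq_add_neg,
          ← sub_eq_add_neg] at this
        exact neg_lt_neg this
    simp only [neg_le_neg_iff] at this
    exact this
  · exact setOf_card_one_minimizer fun p hp => lamMax_removeNodes_lt hn hτ0 hdeg hrev hp
  -- A positive `ε` here becomes the negative perturbation `-ε/τ` of `L`, so the two-sided
  -- comparison `hlt` is needed.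
  · have hscale := (tendsto_const_mul_nhdsNE (neg_ne_zero.2 (inv_ne_zero hτ0.ne'))).eventually hlt
    filter_upwards [nhdsWithin_mono 0 (fun x hx => ne_of_gt hx) hscale] with ε hε
    refine setOf_card_one_minimizer fun p hp => ?_
    rw [lamMax_stochMatrix_add hτ0, lamMax_stochMatrix_add hτ0]
    have := mul_lt_mul_of_pos_left (hε p hp) hτ0
    linarith
  · have htend : Tendsto (fun ε : ℝ => -τ⁻¹ * ε) (𝓝 0) (𝓝 0) := by
      have : Tendsto (fun ε : ℝ => -τ⁻¹ * ε) (𝓝 0) (𝓝 (-τ⁻¹ * 0)) :=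
        (continuous_const.mul continuous_id).tendsto 0
      rwa [mul_zero] at this
    have h := ((agreeUpToSecondOrder_pathLamMin p).comp_tendsto htend).const_mul_left (-τ)
    have h3 : ((fun ε : ℝ => ε ^ 3) ∘ fun ε : ℝ => -τ⁻¹ * ε) =O[𝓝 0] fun ε : ℝ => ε ^ 3 := by
      simp only [Function.comp_def, mul_pow]
      exact (isBigO_refl _ _).const_mul_left _
    refine (h.trans h3).congr_left fun ε => ?_
    simp only [Function.comp_apply]
    rw [lamMax_stochMatrix_add hτ0]
    have := hτ0.ne'
    field_simp
    ring
  · exact neg_lt_neg (div_lt_div_of_pos_right (pathCoeff_lt hpstar hp) hτ0)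
  · intro v hv h j
    rw [pathFiedlerValue_eq] at h
    obtain ⟨c, hc⟩ := eq_smul_pathMode (k := ⟨1, hn⟩) h
    have hc0 : c ≠ 0 := by
      rintro rfl
      exact hv (funext fun i => by rw [hc, zero_mul]; rfl)
    rw [hc, mul_eq_zero, or_iff_right hc0]
    exact pathMode_one_eq_zero_iff pstar hpstar j
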